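/- Let $[n]_2=\{1,1,2,2,\dots,n,n\}$. A Stirling permutation of order $k$ is a permutation $w$ of the multiset $[k]_2$ such that, for each $i\in[k]$, every entry between the two occurrences of $i$ in $w$ is greater than $i$. The reduction of a word is obtained by replacing its $i$th smallest letter (all copies of it) by $i$, for every $i$. A Stirling permutation of the second kind of order $n$ is a sequence $\sigma$ of nonempty words (the cycles of $\sigma$, written in standard cycle form) which together form a permutation of the multiset $[n]_2$, such that: (i) for each $i\in[n]$ the two copies of $i$ appear in the same cycle; (ii) each cycle begins with one of its smallest entries, and the cycles are listed in increasing order of their smallest entries; (iii) the reduction of each cycle $c_1c_2\cdots c_{2k}$ is a Stirling permutation of order $k$. Two of them are the same only if they have the same standard cycle form. Let $\mathcal{Q}_n^2$ be the set of all of them; $\mathcal{Q}_0^2$ consists of the empty sequence only. For $\sigma\in\mathcal{Q}_n^2$ let $\mathrm{cyc}(\sigma)$ be the number of cycles of $\sigma$, let $\mathrm{fix}(\sigma)$ be the number of $k\in[n]$ such that $(kk)$ is a cycle of $\sigma$, and let $\mathrm{cap}(\sigma)$ be the number of cycle ascent plateaus, i.e. of entries $c_i$ of cycles $(c_1,\dots,c_{2k})$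 of $\sigma$ with $2\le i\le 2k-1$ and $c_{i-1}<c_i=c_{i+1}$. Put $$P_n(x,y,q)=\sum_{\sigma\in\mathcal{Q}_n^2}x^{\mathrm{cap}(\sigma)}y^{\mathrm{fix}(\sigma)}q^{\mathrm{cyc}(\sigma)},\qquad Q_n(x,q)=\sum_{\sigma\in\mathcal{Q}_n^2}x^{\mathrm{cap}(\sigma)}q^{\mathrm{cyc}(\sigma)},$$ $$P(x,y,q;z)=\sum_{n\ge0}P_n(x,y,q)\frac{z^n}{n!},\qquad Q(x,q;z)=\sum_{n\ge0}Q_n(x,q)\frac{z^n}{n!},$$ and let $A_n(x)=\sum_{\pi\in\mathfrak{S}_n}x^{\mathrm{des}(\pi)}$ be the Eulerian polynomial, where $\mathrm{des}(\pi)=\#\{i\in[n-1]:\pi(i)>\pi(i+1)\}$. Theorem. We have $P_0(x,y,q)=1$ and $P_1(x,y,q)=yq$, and for every $n\ge1$ $$P_{n+1}(x,y,q)=qyP_n(x,y,q)+qx\sum_{k=0}^{n-1}\binom{n}{k}P_k(x,y,q)\,2^{n-k}A_{n-k}(x),$$ $$P_{n+1}(x,y,q)=(2nx+qy)P_n(x,y,q)+2x(1-x)\frac{\partial}{\partial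 x}P_n(x,y,q)+2x(1-y)\frac{\partial}{\partial y}P_n(x,y,q).$$ Furthermore, as formal power series in $z$ over $\mathbb{Q}[x,y,q]$, $$P(x,y,q;z)=e^{qz(y-1)}\,Q(x,q;z).$$ -/

import Mathlib

namespace StirlingSecondKind

/-- A word `w` is a Stirling permutation of order `k`: it is a permutation of the multiset
`{1,1,2,2,…,k,k}`, and every letter standing between two occurrences of `a` is greater than `a`
(`[a, b, a].Sublist w` says that `b` occurs between two occurrences of `a`). -/
def IsStirlingPerm (k : ℕ) (w : List ℕ) : Prop :=
  (w : Multiset ℕ) = 2 • (Finset.Icc 1 k).val ∧ ∀ a b : ℕ, [a, b, a].Sublist w → a < b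

/-- The reduction of a word: its `i`-th smallest letter is replaced by `i`. -/
def red (w : List ℕ) : List ℕ :=
  w.map fun a => (w.toFinset.filter fun b => b ≤ a).card

/-- `σ`, a list of cycles (each cycle a word), is the standard cycle form of a Stirling
permutation of the second kind of order `n`. -/
structure IsStirlingPermSecond (n : ℕ) (σ : List (List ℕ)) : Prop where
  /-- All cycles are nonempty. -/
  nonempty : ∀ c ∈ σ, c ≠ []
  /-- Together the cycles use each of `1, …, n` exactly twice, and nothing else. -/
  multiset : (σ.flatten : Multiset ℕ) = 2 • (Finset.Icc 1 n).val
  /-- The two copies of each letter are in the same cycle. -/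
  same_cycle : ∀ i ∈ Finset.Icc 1 n, ∃ c ∈ σ, c.count i = 2
  /-- Every cycle starts with one of its smallest letters. -/
  head_min : ∀ c ∈ σ, ∀ a ∈ c, c.headI ≤ a
  /-- The cycles are written in increasing order of their smallest letters. -/
  heads_increasing : σ.Pairwise fun c d => c.headI < d.headI
  /-- The reduction of every cycle is a Stirling permutation. -/
  stirling : ∀ c ∈ σ, ∃ k : ℕ, c.length = 2 * k ∧ IsStirlingPerm k (red c)

theorem finite_words (n m : ℕ) :
    {c : List ℕ | c.length ≤ m ∧ ∀ a ∈ c, a ≤ n}.Finite := by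
  refine ((List.finite_length_le (Fin (n + 1)) m).image (List.map Fin.val)).subset ?_
  rintro c ⟨hl, hc⟩
  refine ⟨c.attach.map fun a => ⟨a.1, Nat.lt_succ_of_le (hc a.1 a.2)⟩, by simpa using hl, ?_⟩
  simp [List.map_map, Function.comp_def]

theorem finite_stirlingPermSecond (n : ℕ) : {σ | IsStirlingPermSecond n σ}.Finite := by
  have hW := finite_words n (2 * n)
  have := hW.to_subtype
  refine ((List.finite_length_le
    {c : List ℕ | c.length ≤ 2 * n ∧ ∀ a ∈ c, a ≤ n} (2 * n)).image
      (List.map Subtype.val)).subset ?_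
  intro σ hσ
  have hlen : σ.flatten.length = 2 * n := by
    have h := congrArg Multiset.card hσ.multiset
    simpa using h
  have hmem : ∀ a ∈ σ.flatten, a ≤ n := by
    intro a ha
    have h : a ∈ (σ.flatten : Multiset ℕ) := by simpa using ha
    rw [hσ.multiset] at h
    have h' := Multiset.mem_of_mem_nsmul h
    simp only [Finset.mem_val, Finset.mem_Icc] at h'
    exact h'.2
  have hc : ∀ c ∈ σ, c ∈ {c : List ℕ | c.length ≤ 2 * n ∧ ∀ a ∈ c, a ≤ n} := by
    intro c hcσ
    refine ⟨?_, fun a ha => hmem a (List.mem_flatten.2 ⟨c, hcσ, ha⟩)⟩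
    rw [← hlen]
    exact (List.sublist_flatten_of_mem hcσ).length_le
  refine ⟨σ.attach.map fun c => ⟨c.1, hc c.1 c.2⟩, ?_, ?_⟩
  · suffices h : σ.length ≤ 2 * n from
      le_of_eq_of_le (by rw [List.length_map, List.length_attach]) h
    rw [← hlen, List.length_flatten]
    have : ∀ k ∈ σ.map List.length, 1 ≤ k := by
      intro k hk
      obtain ⟨c, hcσ, rfl⟩ := List.mem_map.1 hk
      exact List.length_pos_iff.2 (hσ.nonempty c hcσ)
    simpa using List.length_le_sum_of_one_le _ this
  · simp [List.map_map, Function.comp_def]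

/-- The finite set `𝒬ₙ²` of Stirling permutations of the second kind of order `n`, each given by
its standard cycle form. -/
noncomputable def stirlingPermsSecond (n : ℕ) : Finset (List (List ℕ)) :=
  (finite_stirlingPermSecond n).toFinset

/-- The number of indices `i` with `cᵢ₋₁ < cᵢ = cᵢ₊₁` in a cycle `(c₁, c₂, …)`. -/
def capCycle : List ℕ → ℕ
  | a :: b :: c :: l => (if a < b ∧ b = c then 1 else 0) + capCycle (b :: c :: l)
  | _ => 0

/-- The number of cycle ascent plateaus. -/
def cap (σ : List (List ℕ)) : ℕ := (σ.map capCycle).sum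

/-- The number of fixed points: those `k ∈ {1, …, n}` for which `(k k)` is a cycle. -/
def fixNum (n : ℕ) (σ : List (List ℕ)) : ℕ :=
  ((Finset.Icc 1 n).filter fun k => [k, k] ∈ σ).card

/-- The number of cycles. -/
def cyc (σ : List (List ℕ)) : ℕ := σ.length

/-- The polynomial ring `ℚ[x, y, q]`. -/
abbrev PolyRing : Type := MvPolynomial (Fin 3) ℚ

/-- The variable `x`. -/
noncomputable abbrev x : PolyRing := MvPolynomial.X 0

/-- The variable `y`. -/
noncomputable abbrev y : PolyRing := MvPolynomial.X 1

/-- The variable `q`. -/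
noncomputable abbrev q : PolyRing := MvPolynomial.X 2

/-- `Pₙ(x, y, q)`. -/
noncomputable def P (n : ℕ) : PolyRing :=
  ∑ σ ∈ stirlingPermsSecond n, x ^ cap σ * y ^ fixNum n σ * q ^ cyc σ

/-- `Qₙ(x, q)`. -/
noncomputable def Q (n : ℕ) : PolyRing :=
  ∑ σ ∈ stirlingPermsSecond n, x ^ cap σ * q ^ cyc σ

/-- The number of descents of a permutation. -/
def des {n : ℕ} (π : Equiv.Perm (Fin n)) : ℕ :=
  (Finset.univ.filter fun i : Fin n => ∃ h : (i : ℕ) + 1 < n, π ⟨i + 1, h⟩ < π i).card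

/-- The Eulerian polynomial `Aₙ(x) = ∑_π x ^ des π`. -/
noncomputable def eulerianA (n : ℕ) : PolyRing :=
  ∑ π : Equiv.Perm (Fin n), x ^ des π

/-- The exponential generating function `∑ₙ fₙ zⁿ / n!`, a formal power series in `z` over
`ℚ[x, y, q]`. -/
noncomputable def egf (f : ℕ → PolyRing) : PowerSeries PolyRing :=
  PowerSeries.mk fun n => ((n.factorial : ℚ)⁻¹) • f n

end StirlingSecondKind

open StirlingSecondKind

/-! Everything rests on one insertion argument. In a form of order `n + 1` the two copies of `N = n
+ 1` are adjacent, and deleting them leaves a form of order `n`. Conversely `N N` may be put after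
any of the `2n` letters or form a new last cycle. A new cycle contributes `q * y`. An insertion adds
one ascent plateau unless it breaks an old one (two slots per plateau), and it destroys a fixed
point whenever it enters one. These corrections are exactly the derivation `insDer`, so `f (n + 1) =
(2 * n * x + a) * f n + insDer (f n)` holds for `P` with `a = q * y` (`P_succ`) and for `Q` with `a
= q` (`Q_succ`).

The other two identities need no further combinatorics. Such a recurrence determines the sequence
from its initial term (`eq_of_recurrence`), and binomial convolution adds the parameters `a`
(`binomConv_recurrence`). By the Eulerian recurrence `cycleWeight` has parameter `2 * x`, so `q *
binomConv P cycleWeight n` and `P (n + 1)` share the parameter `2 * x + q * y`. The powers of `q *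
(y - 1)` have parameter `q * (y - 1)`, so convolving them with `Q` gives `P`. -/

namespace StirlingSecondKind

/-! ### Eulerian polynomials via descents of words -/

/-- The number of descents of a word. -/
def wordDes : List ℕ → ℕ
  | a :: b :: l => (if b < a then 1 else 0) + wordDes (b :: l)
  | _ => 0

theorem wordDes_ofFn : ∀ {n : ℕ} (f : Fin n → ℕ), wordDes (List.ofFn f) =
    ∑ i : Fin n, if ∃ h : (i : ℕ) + 1 < n, f ⟨i + 1, h⟩ < f i then 1 else 0
  | 0, f => by simp [wordDes]
  | 1, f => by
    rw [Fin.sum_univ_one, if_neg (by rintro ⟨h, -⟩; simp at h)]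
    simp [wordDes]
  | n + 2, f => by
    have ih := wordDes_ofFn (fun i : Fin (n + 1) => f i.succ)
    rw [List.ofFn_succ] at ih
    rw [List.ofFn_succ, List.ofFn_succ, wordDes, ih, Fin.sum_univ_succ (n := n + 1)]
    refine congrArg₂ _ ?_ (Finset.sum_congr rfl fun i _ => ?_)
    · simp only [Fin.val_zero, zero_add, Nat.lt_add_left_iff_pos, Nat.zero_lt_succ, exists_true_left]
      split_ifs <;> first | rfl | contradiction
    · simp

theorem wordDes_ofFn_perm {n : ℕ} (π : Equiv.Perm (Fin n)) :
    wordDes (List.ofFn fun i => (π i : ℕ)) = des π := by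
  rw [wordDes_ofFn, des, Finset.card_filter]
  simp

theorem wordDes_cons_of_lt {N a : ℕ} (l : List ℕ) (h : a < N) :
    wordDes (N :: a :: l) = 1 + wordDes (a :: l) := by
  simp [wordDes, h]

/-- The descent enumerator of the words obtained from `a :: l` by inserting a new largest letter
after one of the letters. -/
theorem sum_wordDes_insert_after {R : Type*} [CommRing R] (x : R) {N : ℕ} :
    ∀ (a : ℕ) (l : List ℕ), (∀ b ∈ a :: l, b < N) →
      (((l.permutations'Aux N).map (a :: ·)).map fun w => x ^ wordDes w).sum =
        (1 + wordDes (a :: l)) * x ^ wordDes (a :: l) +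
          ((l.length : R) - wordDes (a :: l)) * x ^ (wordDes (a :: l) + 1)
  | a, [], h => by
    have : a < N := h a (by simp)
    simp [List.permutations'Aux, wordDes, this.le]
  | a, b :: l, h => by
    have ih := sum_wordDes_insert_after x b l fun c hc => h c (List.mem_cons_of_mem _ hc)
    have ha : a < N := h a (by simp)
    have hb : b < N := h b (by simp)
    have key : ∀ w : List ℕ, x ^ wordDes (a :: b :: w) =
        x ^ (if b < a then 1 else 0) * x ^ wordDes (b :: w) := fun w => by
      rw [wordDes, pow_add]
    have hfirst : wordDes (a :: N :: b :: l) = 1 + wordDes (b :: l) := by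
      rw [wordDes, wordDes_cons_of_lt _ hb]; simp [ha.le]
    simp only [List.map_map, Function.comp_def] at ih
    simp only [List.permutations'Aux, List.map_cons, List.sum_cons, List.map_map,
      Function.comp_def, key, List.sum_map_mul_left, ih, hfirst, List.length_cons]
    rw [show wordDes (a :: b :: l) = (if b < a then 1 else 0) + wordDes (b :: l) from rfl]
    split_ifs <;> push_cast <;> ring

theorem sum_wordDes_insert {R : Type*} [CommRing R] (x : R) {N : ℕ} (l : List ℕ)
    (h : ∀ b ∈ l, b < N) :
    ((l.permutations'Aux N).map fun w => x ^ wordDes w).sum =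
      (1 + wordDes l) * x ^ wordDes l +
        ((l.length : R) - wordDes l) * x ^ (wordDes l + 1) := by
  cases l with
  | nil => simp [List.permutations'Aux, wordDes]
  | cons a l =>
    rw [List.permutations'Aux, List.map_cons, List.sum_cons, sum_wordDes_insert_after x a l h,
      wordDes_cons_of_lt _ (h a (by simp)), List.length_cons]
    push_cast; ring

/-- The range is reversed so that `permutations'`, which inserts the head into the permutations of
the tail, inserts the largest letter last. -/
theorem eulerianA_eq_sum_words (n : ℕ) :
    eulerianA n = (((List.range n).reverse.permutations').map fun w => x ^ wordDes w).sum := by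
  have hnd : ((List.range n).reverse.permutations').Nodup :=
    (List.permutations_perm_permutations' _).nodup_iff.1
      (List.nodup_permutations _ (by simpa using List.nodup_range))
  have hinj : Function.Injective fun π : Equiv.Perm (Fin n) => List.ofFn fun i => (π i : ℕ) := by
    intro π ρ h
    ext i
    exact congrFun (List.ofFn_injective h) i
  have himg : Finset.univ.image (fun π : Equiv.Perm (Fin n) => List.ofFn fun i => (π i : ℕ)) =
      ((List.range n).reverse.permutations').toFinset := by
    refine Finset.eq_of_subset_of_card_le ?_ ?_
    · intro w hw
      obtain ⟨π, -, rfl⟩ := Finset.mem_image.1 hw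
      rw [List.mem_toFinset, List.mem_permutations']
      refine List.Perm.trans ?_ (List.reverse_perm _).symm
      rw [List.perm_ext_iff_of_nodup ?_ List.nodup_range]
      · intro a
        simp only [List.mem_ofFn, List.mem_range]
        constructor
        · rintro ⟨i, rfl⟩; exact (π i).2
        · intro h; exact ⟨π.symm ⟨a, h⟩, by simp⟩
      · exact List.nodup_ofFn.2 fun i j h => π.injective (Fin.ext h)
    · rw [List.toFinset_card_of_nodup hnd, Finset.card_image_of_injective _ hinj,
        ← (List.permutations_perm_permutations' _).length_eq, List.length_permutations]
      simp [Fintype.card_perm]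
  rw [← List.sum_toFinset _ hnd, ← himg, Finset.sum_image hinj.injOn, eulerianA]
  exact Finset.sum_congr rfl fun π _ => by rw [wordDes_ofFn_perm]

theorem pderiv_list_sum {σ R ι : Type*} [CommSemiring R] (i : σ) (l : List ι)
    (f : ι → MvPolynomial σ R) :
    MvPolynomial.pderiv i (l.map f).sum = (l.map fun a => MvPolynomial.pderiv i (f a)).sum := by
  rw [map_list_sum, List.map_map]; rfl

theorem mul_pderiv_zero_x_pow (d : ℕ) :
    x * MvPolynomial.pderiv 0 (x ^ d) = (d : PolyRing) * x ^ d := by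
  cases d with
  | zero => simp
  | succ d => rw [Derivation.leibniz_pow]; simp; ring

theorem eulerianA_zero : eulerianA 0 = 1 := by
  simp [eulerianA_eq_sum_words, wordDes]

/-- Inserting a new maximum into a word with `d` descents keeps `d` in `d + 1` slots (inside a
descent or at the end) and raises it in the other `n - d`. The factor `d` is produced by `x * ∂/∂x`.
-/
theorem eulerianA_succ (n : ℕ) :
    eulerianA (n + 1) = (1 + n * x) * eulerianA n +
      x * (1 - x) * MvPolynomial.pderiv 0 (eulerianA n) := by
  rw [eulerianA_eq_sum_words n, pderiv_list_sum, ← List.sum_map_mul_left, ← List.sum_map_mul_left,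
    ← List.sum_map_add, eulerianA_eq_sum_words, List.range_succ, List.reverse_append,
    List.reverse_singleton, List.singleton_append, List.permutations', List.map_flatMap,
    List.flatMap_def, List.sum_flatten, List.map_map]
  congr 1
  refine List.map_congr_left fun w hw => ?_
  rw [List.mem_permutations'] at hw
  rw [Function.comp_apply, sum_wordDes_insert, hw.length_eq]
  · rw [mul_comm x (1 - x), mul_assoc (1 - x), mul_pderiv_zero_x_pow]
    simp; ring
  · intro b hb
    simpa using hw.mem_iff.1 hb

/-! ### Binomial convolution and first-order recurrences -/

/-- The binomial convolution `∑ₖ C(n,k) fₖ gₙ₋ₖ`. -/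
noncomputable def binomConv {R : Type*} [CommSemiring R] (f g : ℕ → R) (n : ℕ) : R :=
  ∑ p ∈ Finset.HasAntidiagonal.antidiagonal n, (n.choose p.1 : R) * (f p.1 * g p.2)

theorem binomConv_succ {R : Type*} [CommSemiring R] (f g : ℕ → R) (n : ℕ) :
    binomConv f g (n + 1) =
      binomConv (fun k => f (k + 1)) g n + binomConv f (fun k => g (k + 1)) n := by
  have := Finset.sum_antidiagonal_choose_succ_mul (fun i j => f i * g j) n
  rw [binomConv, this, add_comm]
  refine congrArg₂ _ (Finset.sum_congr rfl fun p hp => ?_) rfl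
  -- Pascal's rule yields `n.choose p.2` in this half; symmetry turns it into `n.choose p.1`.
  rw [← Nat.choose_symm_of_eq_add (Finset.HasAntidiagonal.mem_antidiagonal.1 hp).symm]

/-- The derivation `2x(1-x) ∂/∂x + 2x(1-y) ∂/∂y`. -/
noncomputable def insDer : Derivation ℚ PolyRing PolyRing :=
  (2 * x * (1 - x)) • MvPolynomial.pderiv 0 + (2 * x * (1 - y)) • MvPolynomial.pderiv 1

theorem insDer_apply (f : PolyRing) : insDer f =
    2 * x * (1 - x) * MvPolynomial.pderiv 0 f + 2 * x * (1 - y) * MvPolynomial.pderiv 1 f := by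
  simp [insDer]

theorem insDer_natCast_mul (m : ℕ) (f : PolyRing) : insDer ((m : PolyRing) * f) = m * insDer f := by
  rw [← nsmul_eq_mul, map_nsmul, nsmul_eq_mul]

theorem insDer_x : insDer x = 2 * x * (1 - x) := by
  simp [insDer_apply, MvPolynomial.pderiv_X]

theorem insDer_y : insDer y = 2 * x * (1 - y) := by
  simp [insDer_apply, MvPolynomial.pderiv_X]

theorem insDer_q : insDer q = 0 := by
  simp [insDer_apply, MvPolynomial.pderiv_X]

/-- If `f` and `g` satisfy the first-order recurrences with parameters `a` and `b`, then their
binomial convolution satisfies it with parameter `a + b`. -/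
theorem binomConv_recurrence {f g : ℕ → PolyRing} {a b : PolyRing}
    (hf : ∀ n : ℕ, f (n + 1) = (2 * n * x + a) * f n + insDer (f n))
    (hg : ∀ n : ℕ, g (n + 1) = (2 * n * x + b) * g n + insDer (g n)) (n : ℕ) :
    binomConv f g (n + 1) =
      (2 * n * x + (a + b)) * binomConv f g n + insDer (binomConv f g n) := by
  rw [binomConv_succ]
  simp only [binomConv, map_sum, Finset.mul_sum, ← Finset.sum_add_distrib]
  refine Finset.sum_congr rfl fun p hp => ?_
  rw [← Finset.HasAntidiagonal.mem_antidiagonal.1 hp, hf, hg, insDer_natCast_mul, Derivation.leibniz]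
  simp only [smul_eq_mul]
  push_cast
  ring

theorem eq_of_recurrence {f g : ℕ → PolyRing} {a : PolyRing} (h0 : f 0 = g 0)
    (hf : ∀ n : ℕ, f (n + 1) = (2 * n * x + a) * f n + insDer (f n))
    (hg : ∀ n : ℕ, g (n + 1) = (2 * n * x + a) * g n + insDer (g n)) (n : ℕ) : f n = g n := by
  induction n with
  | zero => exact h0
  | succ n ih => rw [hf, hg, ih]

/-- The one-cycle weights: `y` for `n = 0` and `2ⁿ x Aₙ(x)` for `n ≥ 1`. -/
noncomputable def cycleWeight (n : ℕ) : PolyRing :=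
  if n = 0 then y else 2 ^ n * (x * eulerianA n)

theorem pderiv_one_eulerianA (n : ℕ) : MvPolynomial.pderiv 1 (eulerianA n) = 0 := by
  rw [eulerianA, map_sum]
  exact Finset.sum_eq_zero fun π _ => by
    rw [Derivation.leibniz_pow]; simp [MvPolynomial.pderiv_X]

/-- For `n = 0` the terms in `y` cancel and leave `2 * x`. For `n ≥ 1` only the `x`-part of `insDer`
acts, and Leibniz on `x * eulerianA n` reduces the claim to `eulerianA_succ`, each step giving one
factor 2. -/
theorem cycleWeight_succ (n : ℕ) :
    cycleWeight (n + 1) = (2 * n * x + 2 * x) * cycleWeight n + insDer (cycleWeight n) := by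
  rcases Nat.eq_zero_or_pos n with rfl | hn
  · simp only [cycleWeight, eulerianA_succ, eulerianA_zero, if_true, insDer_y]
    simp; ring
  · simp only [cycleWeight, hn.ne', if_false, Nat.succ_ne_zero]
    rw [show (2 : PolyRing) ^ n = ((2 ^ n : ℕ) : PolyRing) by push_cast; rfl, insDer_natCast_mul,
      Derivation.leibniz, insDer_x, insDer_apply, pderiv_one_eulerianA, eulerianA_succ]
    simp only [smul_eq_mul]
    push_cast
    ring

theorem egf_eq_rescale_exp_mul_egf {f g : ℕ → PolyRing} {a : PolyRing}
    (h : ∀ n, f n = binomConv (fun k => a ^ k) g n) :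
    egf f = PowerSeries.rescale a (PowerSeries.exp PolyRing) * egf g := by
  ext1 n
  simp only [egf, PowerSeries.coeff_mk, PowerSeries.coeff_mul, PowerSeries.coeff_rescale,
    PowerSeries.coeff_exp, h, binomConv, Finset.smul_sum]
  refine Finset.sum_congr rfl fun p hp => ?_
  obtain rfl := Finset.HasAntidiagonal.mem_antidiagonal.1 hp
  rw [Algebra.smul_def, Algebra.smul_def, ← map_natCast (algebraMap ℚ PolyRing),
    Nat.cast_add_choose]
  have h1 : ((p.1 + p.2).factorial : ℚ) ≠ 0 := by positivity
  have key : ((p.1 + p.2).factorial : ℚ)⁻¹ *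
      ((p.1 + p.2).factorial / (p.1.factorial * p.2.factorial)) =
      (1 / p.1.factorial) * (p.2.factorial : ℚ)⁻¹ := by
    field_simp
  rw [← mul_assoc, ← map_mul, key, map_mul]
  ring

/-! ### Insertion of twins and its inverse -/

/-- All words obtained from `w` by inserting `N N` directly after one of its letters. -/
def insertTwin (N : ℕ) : List ℕ → List (List ℕ)
  | [] => []
  | a :: l => (a :: N :: N :: l) :: (insertTwin N l).map (a :: ·)

/-- All cycle forms obtained from `σ` by inserting `N N` directly after one letter of a cycle. -/
def insertTwinCycles (N : ℕ) : List (List ℕ) → List (List (List ℕ))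
  | [] => []
  | c :: σ => (insertTwin N c).map (· :: σ) ++ (insertTwinCycles N σ).map (c :: ·)

/-- All cycle forms obtained from `σ` by inserting `N N`, possibly as a new last cycle. -/
def children (N : ℕ) (σ : List (List ℕ)) : List (List (List ℕ)) :=
  (σ ++ [[N, N]]) :: insertTwinCycles N σ

/-- The condition `u ≠ []` excludes insertion at the front, which would spoil the minimality of the
head of the cycle. -/
theorem mem_insertTwin {N : ℕ} {w w' : List ℕ} :
    w' ∈ insertTwin N w ↔ ∃ u v, u ≠ [] ∧ w = u ++ v ∧ w' = u ++ N :: N :: v := by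
  induction w generalizing w' with
  | nil => simp [insertTwin]
  | cons a l ih =>
    simp only [insertTwin, List.mem_cons, List.mem_map, ih]
    constructor
    · rintro (rfl | ⟨_, ⟨u, v, -, rfl, rfl⟩, rfl⟩)
      · exact ⟨[a], l, by simp⟩
      · exact ⟨a :: u, v, by simp⟩
    · rintro ⟨_ | ⟨b, u⟩, v, hu, h, rfl⟩
      · exact absurd rfl hu
      · simp only [List.cons_append, List.cons.injEq] at h
        obtain ⟨rfl, rfl⟩ := h
        cases u with
        | nil => simp
        | cons c u => exact Or.inr ⟨_, ⟨c :: u, v, List.cons_ne_nil _ _, rfl, rfl⟩, rfl⟩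

theorem mem_insertTwinCycles {N : ℕ} {σ τ : List (List ℕ)} :
    τ ∈ insertTwinCycles N σ ↔
      ∃ s u v t, u ≠ [] ∧ σ = s ++ (u ++ v) :: t ∧ τ = s ++ (u ++ N :: N :: v) :: t := by
  induction σ generalizing τ with
  | nil => simp [insertTwinCycles]
  | cons c σ ih =>
    simp only [insertTwinCycles, List.mem_append, List.mem_map, ih, mem_insertTwin]
    constructor
    · rintro (⟨_, ⟨u, v, hu, rfl, rfl⟩, rfl⟩ | ⟨_, ⟨s, u, v, t, hu, rfl, rfl⟩, rfl⟩)
      · exact ⟨[], u, v, σ, hu, by simp⟩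
      · exact ⟨c :: s, u, v, t, hu, by simp⟩
    · rintro ⟨_ | ⟨d, s⟩, u, v, t, hu, h, rfl⟩
      · simp only [List.nil_append, List.cons.injEq] at h
        obtain ⟨rfl, rfl⟩ := h
        exact Or.inl ⟨_, ⟨u, v, hu, rfl, rfl⟩, rfl⟩
      · simp only [List.cons_append, List.cons.injEq] at h
        obtain ⟨rfl, rfl⟩ := h
        exact Or.inr ⟨_, ⟨s, u, v, t, hu, rfl, rfl⟩, rfl⟩

theorem nodup_insertTwin {N : ℕ} {w : List ℕ} (h : N ∉ w) : (insertTwin N w).Nodup := by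
  induction w with
  | nil => simp [insertTwin]
  | cons a l ih =>
    rw [insertTwin, List.nodup_cons]
    refine ⟨?_, (ih (by simp_all)).map (List.cons_injective)⟩
    simp only [List.mem_map, mem_insertTwin]
    rintro ⟨_, ⟨u, v, hu, rfl, rfl⟩, hc⟩
    cases u with
    | nil => exact hu rfl
    | cons b u => simp at hc; simp_all

theorem nodup_insertTwinCycles {N : ℕ} {σ : List (List ℕ)} (h : ∀ c ∈ σ, N ∉ c) :
    (insertTwinCycles N σ).Nodup := by
  induction σ with
  | nil => simp [insertTwinCycles]
  | cons c σ ih =>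
    rw [insertTwinCycles, List.nodup_append']
    refine ⟨(nodup_insertTwin (h c (by simp))).map fun a b hab => by simpa using hab,
      (ih fun d hd => h d (by simp [hd])).map List.cons_injective, ?_⟩
    intro τ h1 h2
    simp only [List.mem_map, mem_insertTwin] at h1 h2
    obtain ⟨_, ⟨u, v, -, rfl, rfl⟩, rfl⟩ := h1
    obtain ⟨_, -, h2⟩ := h2
    -- An insertion into the first cycle lengthens it by two, while one into a later cycle leaves it
    -- unchanged.
    have := congrArg List.length (List.cons.inj h2).1
    simp only [List.length_append, List.length_cons] at this
    omega

theorem nodup_children {N : ℕ} {σ : List (List ℕ)} (h : ∀ c ∈ σ, N ∉ c) :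
    (children N σ).Nodup := by
  rw [children, List.nodup_cons]
  refine ⟨fun hm => ?_, nodup_insertTwinCycles h⟩
  obtain ⟨s, u, v, t, -, rfl, h2⟩ := mem_insertTwinCycles.1 hm
  have := congrArg List.length h2
  simp at this

/-- Removal of the letter `N` from all cycles, dropping cycles that become empty. -/
def removeLetter (N : ℕ) (τ : List (List ℕ)) : List (List ℕ) :=
  (τ.map (List.filter (· ≠ N))).filter (· ≠ [])

theorem removeLetter_eq_self {N : ℕ} {σ : List (List ℕ)} (hne : ∀ c ∈ σ, c ≠ [])
    (h : ∀ c ∈ σ, N ∉ c) : removeLetter N σ = σ := by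
  have h1 : σ.map (List.filter (· ≠ N)) = σ := by
    conv_rhs => rw [← List.map_id σ]
    refine List.map_congr_left fun c hc => ?_
    rw [id, List.filter_eq_self]
    intro a ha
    simpa using fun e : a = N => h c hc (e ▸ ha)
  rw [removeLetter, h1, List.filter_eq_self]
  simpa using hne

/-- Since the parent can be recovered, distinct forms have disjoint sets of children. -/
theorem removeLetter_of_mem_children {N : ℕ} {σ τ : List (List ℕ)} (hne : ∀ c ∈ σ, c ≠ [])
    (h : ∀ c ∈ σ, N ∉ c) (hτ : τ ∈ children N σ) : removeLetter N τ = σ := by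
  rcases List.mem_cons.1 hτ with rfl | hτ
  · conv_rhs => rw [← removeLetter_eq_self hne h]
    simp [removeLetter]
  · obtain ⟨s, u, v, t, -, rfl, rfl⟩ := mem_insertTwinCycles.1 hτ
    conv_rhs => rw [← removeLetter_eq_self hne h]
    simp [removeLetter]

/-! ### Weights and their change under insertion -/

/-- Whether a cycle is of the form `(k k)`. -/
def fixCycle : List ℕ → ℕ
  | [a, b] => if a = b then 1 else 0
  | _ => 0

/-- The weight of a cycle. -/
noncomputable def weightCycle (v : PolyRing) (c : List ℕ) : PolyRing :=
  x ^ capCycle c * v ^ fixCycle c * q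

/-- The weight of a cycle form: the product of the weights of the cycles. -/
noncomputable def weight (v : PolyRing) (σ : List (List ℕ)) : PolyRing :=
  (σ.map (weightCycle v)).prod

theorem capCycle_twin (N : ℕ) (l : List ℕ) (h : ∀ b ∈ l, b < N) :
    capCycle (N :: N :: l) = capCycle l := by
  have h1 : capCycle (N :: l) = capCycle l := by
    match l, h with
    | [], _ => rfl
    | [a], _ => rfl
    | a :: b :: l, h => simp [capCycle, (h a (by simp)).le]
  cases l with
  | nil => rfl
  | cons a l => rw [capCycle, h1]; simp

theorem capCycle_insert_first {N a : ℕ} (l : List ℕ) (ha : a < N) (h : ∀ b ∈ l, b < N) :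
    capCycle (a :: N :: N :: l) = 1 + capCycle l := by
  rw [capCycle, capCycle_twin N l h]; simp [ha]

/-- The ascent plateau enumerator of the words obtained from `w` by inserting `N N` after one of
the letters. -/
theorem sum_capCycle_insertTwin {R : Type*} [CommRing R] (x : R) {N : ℕ} :
    ∀ w : List ℕ, (∀ b ∈ w, b < N) →
      ((insertTwin N w).map fun w' => x ^ capCycle w').sum =
        w.length * x ^ (capCycle w + 1) +
          2 * capCycle w * (x ^ capCycle w - x ^ (capCycle w + 1))
  | [], _ => by simp [insertTwin, capCycle]
  | [a], h => by
    simp [insertTwin, capCycle, h a (by simp)]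
  | [a, b], h => by
    have := h a (by simp)
    have := h b (by simp)
    simp only [insertTwin, capCycle, List.map_cons, List.map_nil, List.sum_cons, List.sum_nil,
      List.length_cons, List.length_nil]
    have h1 : ¬ N < b := by omega
    have h2 : b ≠ N := by omega
    simp [*]
    ring
  | a :: b :: c :: l, h => by
    have ha := h a (by simp)
    have hb := h b (by simp)
    have hl : ∀ d ∈ c :: l, d < N := fun d hd => h d (by simp_all)
    have ih := sum_capCycle_insertTwin x (b :: c :: l) fun d hd => h d (by simp_all)
    have h1 : capCycle (a :: N :: N :: b :: c :: l) = 1 + capCycle (b :: c :: l) :=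
      capCycle_insert_first _ ha fun d hd => h d (by simp_all)
    have h2 : capCycle (a :: b :: N :: N :: c :: l) = 1 + capCycle (c :: l) := by
      rw [capCycle, capCycle_insert_first _ hb hl]; simp [hb.ne]
    have h3 : capCycle (b :: N :: N :: c :: l) = 1 + capCycle (c :: l) :=
      capCycle_insert_first _ hb hl
    have hr : ∀ w' ∈ insertTwin N (c :: l), x ^ capCycle (a :: b :: w') =
        x ^ (if a < b ∧ b = c then 1 else 0) * x ^ capCycle (b :: w') := by
      intro w' hw'
      obtain ⟨u, v, hu, h4, rfl⟩ := mem_insertTwin.1 hw'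
      obtain ⟨d, u, rfl⟩ := List.exists_cons_of_ne_nil hu
      obtain ⟨rfl, -⟩ := List.cons.inj h4
      rw [List.cons_append, capCycle, pow_add]
    rw [insertTwin, List.map_cons, List.sum_cons, h3, List.map_map] at ih
    rw [insertTwin, insertTwin, List.map_cons, List.map_cons, List.map_cons, List.sum_cons,
      List.sum_cons, List.map_map, List.map_map, h1, h2]
    have h5 : (List.map (((fun w' => x ^ capCycle w') ∘ fun w' => a :: w') ∘ fun w' => b :: w')
        (insertTwin N (c :: l))).sum = x ^ (if a < b ∧ b = c then 1 else 0) *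
        (List.map ((fun w' => x ^ capCycle w') ∘ fun w' => b :: w')
          (insertTwin N (c :: l))).sum := by
      rw [← List.sum_map_mul_left]
      exact congrArg _ (List.map_congr_left hr)
    -- The slots from `c` onwards are all slots of `b :: c :: l` except the one after `b`, hence the
    -- induction hypothesis minus one term. That term cancels the slot after `b` here, unless `a < b
    -- = c` is a plateau, when it carries an extra factor `x`.
    rw [h5, eq_sub_of_add_eq' ih,
      show capCycle (a :: b :: c :: l) =
        (if a < b ∧ b = c then 1 else 0) + capCycle (b :: c :: l) from rfl]
    split_ifs with h6
    · obtain ⟨-, rfl⟩ := h6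
      have h7 : capCycle (b :: b :: l) = capCycle (b :: l) := by
        cases l <;> simp [capCycle]
      rw [h7]
      simp only [List.length_cons]
      push_cast
      ring
    · simp only [List.length_cons]
      push_cast
      ring

theorem insDer_x_pow (d : ℕ) : insDer (x ^ d) = 2 * d * (x ^ d - x ^ (d + 1)) := by
  rw [Derivation.leibniz_pow, insDer_x]
  cases d with
  | zero => simp
  | succ d => simp; ring

theorem fixCycle_of_length_ne_two {c : List ℕ} (h : c.length ≠ 2) : fixCycle c = 0 := by
  match c, h with
  | [], _ => rfl
  | [_], _ => rfl
  | [_, _], h => simp at h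
  | _ :: _ :: _ :: _, _ => rfl

theorem fixCycle_of_mem_insertTwin {N : ℕ} {c c' : List ℕ} (h : c' ∈ insertTwin N c) :
    fixCycle c' = 0 := by
  obtain ⟨u, v, hu, -, rfl⟩ := mem_insertTwin.1 h
  have := List.length_pos_iff.2 hu
  refine fixCycle_of_length_ne_two ?_
  simp only [List.length_append, List.length_cons]
  omega

/-- The hypothesis `hv` holds for both `v = y` and `v = 1`, so `P` and `Q` are treated together. On
a cycle `(a a)` both insertions replace `v` by `x`, and `2 * x * v + insDer v = 2 * x` records this.
-/
theorem sum_weightCycle_insertTwin {v : PolyRing} (hv : insDer v = 2 * x * (1 - v)) {N : ℕ}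
    (c : List ℕ) (h : ∀ b ∈ c, b < N) :
    ((insertTwin N c).map (weightCycle v)).sum =
      c.length * x * weightCycle v c + insDer (weightCycle v c) := by
  have h1 : (insertTwin N c).map (weightCycle v) =
      (insertTwin N c).map fun w => x ^ capCycle w * q :=
    List.map_congr_left fun w hw => by simp [weightCycle, fixCycle_of_mem_insertTwin hw]
  rw [h1, List.sum_map_mul_right, sum_capCycle_insertTwin x c h]
  by_cases h2 : fixCycle c = 0
  · simp only [weightCycle, h2, pow_zero, mul_one]
    rw [Derivation.leibniz, insDer_q, insDer_x_pow]
    simp only [smul_eq_mul]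
    ring
  · obtain ⟨a, rfl⟩ : ∃ a, c = [a, a] := by
      match c, h2 with
      | [a, b], h2 =>
        simp only [fixCycle, ite_eq_right_iff, one_ne_zero, imp_false, not_not] at h2
        exact ⟨a, by rw [h2]⟩
      | [], h2 => simp [fixCycle] at h2
      | [_], h2 => simp [fixCycle] at h2
      | _ :: _ :: _ :: _, h2 => simp [fixCycle] at h2
    simp only [weightCycle, fixCycle, capCycle, if_true, pow_one, pow_zero, one_mul]
    rw [Derivation.leibniz, insDer_q, hv]
    simp
    ring

/-- The weight is a product over cycles and an insertion alters one factor, which is the Leibniz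
rule. -/
theorem sum_weight_insertTwinCycles {v : PolyRing} (hv : insDer v = 2 * x * (1 - v)) {N : ℕ}
    (σ : List (List ℕ)) (h : ∀ c ∈ σ, ∀ b ∈ c, b < N) :
    ((insertTwinCycles N σ).map (weight v)).sum =
      σ.flatten.length * x * weight v σ + insDer (weight v σ) := by
  induction σ with
  | nil => simp [insertTwinCycles, weight]
  | cons c σ ih =>
    have ih := ih fun d hd => h d (by simp [hd])
    have hw : ∀ (c : List ℕ) (σ : List (List ℕ)), weight v (c :: σ) = weightCycle v c * weight v σ :=
      fun c σ => by simp [weight]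
    simp only [insertTwinCycles, List.map_append, List.map_map, List.sum_append, Function.comp_def,
      hw, List.sum_map_mul_left, List.sum_map_mul_right, ih,
      sum_weightCycle_insertTwin hv c (h c (by simp)), Derivation.leibniz, smul_eq_mul,
      List.flatten_cons, List.length_append]
    push_cast
    ring

theorem sum_weight_children {v : PolyRing} (hv : insDer v = 2 * x * (1 - v)) {N : ℕ}
    (σ : List (List ℕ)) (h : ∀ c ∈ σ, ∀ b ∈ c, b < N) :
    ((children N σ).map (weight v)).sum =
      (σ.flatten.length * x + q * v) * weight v σ + insDer (weight v σ) := by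
  rw [children, List.map_cons, List.sum_cons, sum_weight_insertTwinCycles hv σ h]
  have : weight v (σ ++ [[N, N]]) = weight v σ * (v * q) := by
    simp [weight, weightCycle, capCycle, fixCycle]
  rw [this]
  ring

/-! ### Elimination of reductions -/

theorem rank_lt_iff {w : List ℕ} {a b : ℕ} (hb : b ∈ w) :
    (w.toFinset.filter fun d => d ≤ a).card < (w.toFinset.filter fun d => d ≤ b).card ↔ a < b := by
  constructor
  · intro h
    by_contra! hab
    refine absurd h (not_lt.2 (Finset.card_le_card fun d hd => ?_))
    simp only [Finset.mem_filter] at hd ⊢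
    exact ⟨hd.1, hd.2.trans hab⟩
  · intro h
    refine Finset.card_lt_card ⟨fun d hd => ?_, fun hs => ?_⟩
    · simp only [Finset.mem_filter] at hd ⊢
      exact ⟨hd.1, hd.2.trans h.le⟩
    · have := hs (Finset.mem_filter.2 ⟨List.mem_toFinset.2 hb, le_rfl⟩)
      simp only [Finset.mem_filter] at this
      omega

theorem rank_injOn (w : List ℕ) :
    Set.InjOn (fun a => (w.toFinset.filter fun d => d ≤ a).card) (w.toFinset : Set ℕ) := by
  intro a ha b hb h
  simp only [List.coe_toFinset, Set.mem_ofPred_eq] at ha hb h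
  refine le_antisymm (not_lt.1 fun hlt => ?_) (not_lt.1 fun hlt => ?_)
  · exact absurd h ((rank_lt_iff ha).2 hlt).ne'
  · exact absurd h ((rank_lt_iff hb).2 hlt).ne

/-- A word all of whose letters occur twice has a Stirling permutation as its reduction as soon
as the letters between two copies of `a` are greater than `a`. -/
theorem isStirlingPerm_red {w : List ℕ} (h2 : ∀ a ∈ w, w.count a = 2)
    (hs : ∀ a b, [a, b, a].Sublist w → a < b) :
    w.length = 2 * w.toFinset.card ∧ IsStirlingPerm w.toFinset.card (red w) := by
  have hw : (w : Multiset ℕ) = 2 • w.toFinset.val := by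
    ext a
    rw [Multiset.coe_count, Multiset.count_nsmul, Multiset.count_eq_of_nodup w.toFinset.nodup]
    by_cases ha : a ∈ w
    · simp [ha, h2 a ha]
    · simp [ha, List.count_eq_zero_of_not_mem ha]
  refine ⟨?_, ?_, ?_⟩
  · rw [← Multiset.coe_card, hw, Multiset.card_nsmul, Finset.card_val]
  · have himg : w.toFinset.image (fun a => (w.toFinset.filter fun d => d ≤ a).card) =
        Finset.Icc 1 w.toFinset.card := by
      refine Finset.eq_of_subset_of_card_le ?_ ?_
      · intro i hi
        obtain ⟨a, ha, rfl⟩ := Finset.mem_image.1 hi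
        refine Finset.mem_Icc.2 ⟨?_, Finset.card_filter_le _ _⟩
        exact Finset.card_pos.2 ⟨a, Finset.mem_filter.2 ⟨ha, le_rfl⟩⟩
      · rw [Finset.card_image_of_injOn (rank_injOn w)]; simp
    rw [red, ← Multiset.map_coe, hw, Multiset.map_nsmul, ← himg,
      Finset.image_val_of_injOn (rank_injOn w)]
  · intro a b hab
    obtain ⟨l, hl, hm⟩ := List.sublist_map_iff.1 hab
    obtain ⟨a', b', c', rfl⟩ := List.length_eq_three.1 (by simpa using congrArg List.length hm.symm)
    simp only [List.map_cons, List.map_nil, List.cons.injEq, and_true] at hm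
    obtain ⟨rfl, rfl, hc⟩ := hm
    have ha : a' ∈ w := hl.subset (by simp)
    have hc' : c' ∈ w := hl.subset (by simp)
    obtain rfl := rank_injOn w (by simpa using ha) (by simpa using hc') hc
    exact (rank_lt_iff (hl.subset (by simp))).2 (hs _ _ hl)

theorem lt_of_isStirlingPerm_red {k : ℕ} {w : List ℕ} (h : IsStirlingPerm k (red w)) {a b : ℕ}
    (hs : [a, b, a].Sublist w) : a < b :=
  (rank_lt_iff (hs.subset (by simp))).1
    (h.2 _ _ (hs.map fun a => (w.toFinset.filter fun d => d ≤ a).card))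

/-- A description of `IsStirlingPermSecond` by letter counts, without reductions. -/
structure IsTwinForm (n : ℕ) (σ : List (List ℕ)) : Prop where
  nonempty : ∀ c ∈ σ, c ≠ []
  count_flatten : ∀ i, σ.flatten.count i = if 1 ≤ i ∧ i ≤ n then 2 else 0
  count_cycle : ∀ c ∈ σ, ∀ a ∈ c, c.count a = 2
  head_min : ∀ c ∈ σ, ∀ a ∈ c, c.headI ≤ a
  heads_increasing : σ.Pairwise fun c d => c.headI < d.headI
  between : ∀ c ∈ σ, ∀ a b, [a, b, a].Sublist c → a < b

theorem coe_eq_two_nsmul_Icc_iff {n : ℕ} {w : List ℕ} :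
    (w : Multiset ℕ) = 2 • (Finset.Icc 1 n).val ↔
      ∀ i, w.count i = if 1 ≤ i ∧ i ≤ n then 2 else 0 := by
  rw [Multiset.ext]
  refine forall_congr' fun i => ?_
  rw [Multiset.coe_count, Multiset.count_nsmul,
    Multiset.count_eq_of_nodup (Finset.Icc 1 n).nodup]
  simp

theorem isStirlingPermSecond_iff {n : ℕ} {σ : List (List ℕ)} :
    IsStirlingPermSecond n σ ↔ IsTwinForm n σ := by
  constructor
  · intro h
    have hcount := coe_eq_two_nsmul_Icc_iff.1 h.multiset
    refine ⟨h.nonempty, hcount, fun c hc a ha => ?_, h.head_min, h.heads_increasing,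
      fun c hc a b hab => ?_⟩
    · have hpos : 0 < σ.flatten.count a :=
        List.count_pos_iff.2 (List.mem_flatten.2 ⟨c, hc, ha⟩)
      have ha' : 1 ≤ a ∧ a ≤ n := by
        by_contra hn
        rw [hcount, if_neg hn] at hpos
        exact lt_irrefl _ hpos
      obtain ⟨d, hd, hd2⟩ := h.same_cycle a (Finset.mem_Icc.2 ha')
      -- If `d` holds two copies of `a` and `c ≠ d` holds at least one, the total count exceeds 2.
      by_contra hne
      have hcd : c ≠ d := by rintro rfl; exact hne hd2
      have htot := hcount a
      rw [if_pos ha', List.count_flatten] at htot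
      obtain ⟨s, t, rfl⟩ := List.append_of_mem hd
      have hct : c ∈ s ++ t := by simp_all
      have h1 : List.count a c ≤ ((s ++ t).map (List.count a)).sum :=
        List.single_le_sum (by simp) _ (List.mem_map_of_mem hct)
      have h2 : 0 < List.count a c := List.count_pos_iff.2 ha
      simp only [List.map_append, List.map_cons, List.sum_append, List.sum_cons] at htot h1
      omega
    · obtain ⟨k, -, hk⟩ := h.stirling c hc
      exact lt_of_isStirlingPerm_red hk hab
  · intro h
    refine ⟨h.nonempty, coe_eq_two_nsmul_Icc_iff.2 h.count_flatten, fun i hi => ?_, h.head_min,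
      h.heads_increasing, fun c hc => ⟨_, isStirlingPerm_red (h.count_cycle c hc) (h.between c hc)⟩⟩
    have hi' : i ∈ σ.flatten := by
      rw [← List.count_pos_iff, h.count_flatten, if_pos (Finset.mem_Icc.1 hi)]
      norm_num
    obtain ⟨c, hc, hic⟩ := List.mem_flatten.1 hi'
    exact ⟨c, hc, h.count_cycle c hc i hic⟩

theorem mem_stirlingPermsSecond {n : ℕ} {σ : List (List ℕ)} :
    σ ∈ stirlingPermsSecond n ↔ IsTwinForm n σ := by
  rw [stirlingPermsSecond, Set.Finite.mem_toFinset, Set.mem_ofPred_eq, isStirlingPermSecond_iff]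

/-! ### Every form arises by insertion of the largest letter -/

namespace IsTwinForm

variable {n : ℕ} {σ : List (List ℕ)}

theorem bounds (h : IsTwinForm n σ) {c : List ℕ} (hc : c ∈ σ) {a : ℕ} (ha : a ∈ c) :
    1 ≤ a ∧ a ≤ n := by
  have hpos : 0 < σ.flatten.count a := List.count_pos_iff.2 (List.mem_flatten.2 ⟨c, hc, ha⟩)
  by_contra hn
  rw [h.count_flatten, if_neg hn] at hpos
  exact lt_irrefl _ hpos

theorem notMem (h : IsTwinForm n σ) {c : List ℕ} (hc : c ∈ σ) : n + 1 ∉ c := fun hn => by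
  have := h.bounds hc hn
  omega

theorem length_flatten (h : IsTwinForm n σ) : σ.flatten.length = 2 * n := by
  simpa using congrArg Multiset.card (coe_eq_two_nsmul_Icc_iff.2 h.count_flatten)

theorem append_twin_iff :
    IsTwinForm (n + 1) (σ ++ [[n + 1, n + 1]]) ↔ IsTwinForm n σ := by
  constructor
  · intro h
    have hsub : ∀ c ∈ σ, c ∈ σ ++ [[n + 1, n + 1]] := fun c hc => List.mem_append_left _ hc
    refine ⟨fun c hc => h.nonempty c (hsub c hc), fun i => ?_,
      fun c hc => h.count_cycle c (hsub c hc), fun c hc => h.head_min c (hsub c hc),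
      (List.pairwise_append.1 h.heads_increasing).1, fun c hc => h.between c (hsub c hc)⟩
    have := h.count_flatten i
    simp only [List.flatten_append, List.flatten_cons, List.flatten_nil, List.append_nil,
      List.count_append, List.count_cons, List.count_nil, beq_iff_eq] at this
    split_ifs at this ⊢ <;> omega
  · intro h
    have hmem : ∀ c ∈ σ ++ [[n + 1, n + 1]], c ∈ σ ∨ c = [n + 1, n + 1] := by simp
    refine ⟨fun c hc => ?_, fun i => ?_, fun c hc => ?_, fun c hc => ?_, ?_, fun c hc => ?_⟩
    · rcases hmem c hc with hc | rfl
      · exact h.nonempty c hc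
      · simp
    · have := h.count_flatten i
      simp only [List.flatten_append, List.flatten_cons, List.flatten_nil, List.append_nil,
        List.count_append, List.count_cons, List.count_nil, beq_iff_eq, this]
      split_ifs <;> omega
    · rcases hmem c hc with hc | rfl
      · exact h.count_cycle c hc
      · simp
    · rcases hmem c hc with hc | rfl
      · exact h.head_min c hc
      · simp
    · rw [List.pairwise_append]
      refine ⟨h.heads_increasing, by simp, fun c hc d hd => ?_⟩
      obtain ⟨a, l, rfl⟩ := List.exists_cons_of_ne_nil (h.nonempty c hc)
      have := (h.bounds hc (a := a) (by simp)).2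
      simp only [List.mem_singleton] at hd
      subst hd
      simpa using Nat.lt_succ_of_le this
    · rcases hmem c hc with hc | rfl
      · exact h.between c hc
      · intro a b hab
        simpa using hab.length_le

/-- The head of the cycle survives because `u` is nonempty. The new letter is larger than all others
and its copies are adjacent, so it creates no violation of the betweenness condition. -/
theorem insert_twin_iff {s t : List (List ℕ)} {u v : List ℕ} (hu : u ≠ []) (hNu : n + 1 ∉ u)
    (hNv : n + 1 ∉ v) :
    IsTwinForm (n + 1) (s ++ (u ++ (n + 1) :: (n + 1) :: v) :: t) ↔
      IsTwinForm n (s ++ (u ++ v) :: t) := by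
  obtain ⟨a₀, u, rfl⟩ := List.exists_cons_of_ne_nil hu
  have hcount : ∀ i, (s ++ (a₀ :: u ++ (n + 1) :: (n + 1) :: v) :: t).flatten.count i =
      (s ++ (a₀ :: u ++ v) :: t).flatten.count i + if i = n + 1 then 2 else 0 := by
    intro i
    simp only [List.flatten_append, List.flatten_cons, List.count_append, List.count_cons,
      beq_iff_eq]
    split_ifs <;> omega
  have hsub : (a₀ :: u ++ v).Sublist (a₀ :: u ++ (n + 1) :: (n + 1) :: v) :=
    List.Sublist.append_left (((List.Sublist.refl v).cons _).cons _) _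
  have hcc : ∀ i, (a₀ :: u ++ (n + 1) :: (n + 1) :: v).count i =
      (a₀ :: u ++ v).count i + if i = n + 1 then 2 else 0 := by
    intro i
    simp only [List.count_append, List.count_cons, beq_iff_eq]
    split_ifs <;> omega
  constructor
  · intro h
    have hc₀ : (a₀ :: u ++ (n + 1) :: (n + 1) :: v) ∈
      s ++ (a₀ :: u ++ (n + 1) :: (n + 1) :: v) :: t := by simp
    have hmem : ∀ c ∈ s ++ (a₀ :: u ++ v) :: t,
        c ∈ s ++ (a₀ :: u ++ (n + 1) :: (n + 1) :: v) :: t ∨ c = a₀ :: u ++ v := by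
      intro c hc
      simp only [List.mem_append, List.mem_cons] at hc ⊢
      tauto
    refine ⟨fun c hc => ?_, fun i => ?_, fun c hc => ?_, fun c hc => ?_, ?_, fun c hc => ?_⟩
    · rcases hmem c hc with hc | rfl
      · exact h.nonempty c hc
      · simp
    · have := h.count_flatten i
      rw [hcount] at this
      split_ifs at this ⊢ <;> omega
    · rcases hmem c hc with hc | rfl
      · exact h.count_cycle c hc
      · intro a ha
        have h1 := h.count_cycle _ hc₀ a (hsub.subset ha)
        have h2 : a ≠ n + 1 := by
          rintro rfl
          exact (List.mem_append.1 ha).elim hNu hNv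
        rwa [hcc, if_neg h2, add_zero] at h1
    · rcases hmem c hc with hc | rfl
      · exact h.head_min c hc
      · intro a ha
        exact h.head_min _ hc₀ a (hsub.subset ha)
    · have := h.heads_increasing
      simpa [List.pairwise_append] using this
    · rcases hmem c hc with hc | rfl
      · exact h.between c hc
      · intro a b hab
        exact h.between _ hc₀ a b (hab.trans hsub)
  · intro h
    have hc₀ : (a₀ :: u ++ v) ∈ s ++ (a₀ :: u ++ v) :: t := by simp
    have hmem : ∀ c ∈ s ++ (a₀ :: u ++ (n + 1) :: (n + 1) :: v) :: t,
        c ∈ s ++ (a₀ :: u ++ v) :: t ∨ c = a₀ :: u ++ (n + 1) :: (n + 1) :: v := by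
      intro c hc
      simp only [List.mem_append, List.mem_cons] at hc ⊢
      tauto
    have hletter : ∀ a ∈ a₀ :: u ++ (n + 1) :: (n + 1) :: v, a = n + 1 ∨ a ∈ a₀ :: u ++ v := by
      intro a ha
      simp only [List.mem_append, List.mem_cons] at ha ⊢
      tauto
    refine ⟨fun c hc => ?_, fun i => ?_, fun c hc => ?_, fun c hc => ?_, ?_, fun c hc => ?_⟩
    · rcases hmem c hc with hc | rfl
      · exact h.nonempty c hc
      · simp
    · rw [hcount, h.count_flatten]
      split_ifs <;> omega
    · rcases hmem c hc with hc | rfl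
      · exact h.count_cycle c hc
      · intro a ha
        rw [hcc]
        split_ifs with ha'
        · subst ha'
          rw [List.count_eq_zero_of_not_mem (h.notMem hc₀)]
        · exact h.count_cycle _ hc₀ a ((hletter a ha).resolve_left ha')
    · rcases hmem c hc with hc | rfl
      · exact h.head_min c hc
      · intro a ha
        rcases hletter a ha with rfl | ha
        · exact (h.bounds hc₀ (a := a₀) (by simp)).2.trans (Nat.le_succ n)
        · exact h.head_min _ hc₀ a ha
    · have := h.heads_increasing
      simpa [List.pairwise_append] using this
    · rcases hmem c hc with hc | rfl
      · exact h.between c hc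
      · intro a b hab
        by_cases ha : a = n + 1
        · subst ha
          obtain ⟨l₁, l₂, hl, hl₁, hl₂⟩ := List.sublist_append_iff.1 hab
          cases l₁ with
          | cons d l₁ =>
            obtain ⟨rfl, -⟩ := List.cons.inj hl
            exact absurd (hl₁.subset (by simp)) hNu
          | nil =>
            rw [List.nil_append] at hl
            subst hl
            have h1 := (List.cons_sublist_cons.1 hl₂)
            rcases List.sublist_cons_iff.1 h1 with h2 | ⟨r, hr, h2⟩
            · exact absurd (h2.subset (by simp)) hNv
            · obtain ⟨-, rfl⟩ := List.cons.inj hr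
              exact absurd (h2.subset (by simp)) hNv
        · have ha' := (hletter a (hab.subset (by simp))).resolve_left ha
          by_cases hb : b = n + 1
          · have := (h.bounds hc₀ ha').2
            omega
          -- A pattern avoiding `n + 1` survives its deletion and so already occurs in the old
          -- cycle.
          · have := hab.filter (· ≠ n + 1)
            have hf : (a₀ :: u ++ (n + 1) :: (n + 1) :: v).filter (· ≠ n + 1) =
                (a₀ :: u ++ v).filter (· ≠ n + 1) := by
              simp only [List.filter_append]
              simp
            rw [List.filter_eq_self.2 (by simp [ha, hb]), hf, List.filter_eq_self.2] at this
            · exact h.between _ hc₀ a b this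
            · intro d hd
              simpa using fun e : d = n + 1 => h.notMem hc₀ (e ▸ hd)

/-- A letter between the copies of `n + 1` would have to exceed `n + 1`, so they are adjacent. If
they begin a cycle, minimality of the head leaves no other letter in it, and the order of the heads
makes it the last cycle. -/
theorem exists_mem_children {τ : List (List ℕ)} (h : IsTwinForm (n + 1) τ) :
    ∃ σ, IsTwinForm n σ ∧ τ ∈ children (n + 1) σ := by
  have hN : n + 1 ∈ τ.flatten := by
    rw [← List.count_pos_iff, h.count_flatten, if_pos (by omega)]
    norm_num
  obtain ⟨c, hc, hNc⟩ := List.mem_flatten.1 hN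
  have hc2 := h.count_cycle c hc _ hNc
  obtain ⟨u, w, rfl, hu⟩ := List.eq_append_cons_of_mem hNc
  have hw : n + 1 ∈ w := by
    rw [← List.count_pos_iff]
    rw [List.count_append, List.count_cons_self, List.count_eq_zero_of_not_mem hu] at hc2
    omega
  obtain ⟨b, v, rfl⟩ := List.exists_cons_of_ne_nil (List.ne_nil_of_mem hw)
  have hb : b = n + 1 := by
    by_contra hb
    have hv : n + 1 ∈ v := (List.mem_cons.1 hw).resolve_left (Ne.symm hb)
    have h1 : [n + 1, b, n + 1].Sublist (u ++ (n + 1) :: b :: v) :=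
      ((List.singleton_sublist.2 hv).cons_cons b |>.cons_cons (n + 1)).trans
        (List.sublist_append_right _ _)
    have h2 := h.between _ hc _ _ h1
    have h3 := (h.bounds hc (a := b) (by simp)).2
    omega
  subst hb
  have hv : n + 1 ∉ v := by
    rw [← List.count_eq_zero]
    simp only [List.count_append, List.count_cons_self] at hc2
    omega
  obtain ⟨s, t, rfl⟩ := List.append_of_mem hc
  cases u with
  | cons a u =>
    exact ⟨s ++ (a :: u ++ v) :: t,
      (insert_twin_iff (List.cons_ne_nil _ _) hu hv).1 h,
      List.mem_cons_of_mem _ (mem_insertTwinCycles.2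
        ⟨s, a :: u, v, t, List.cons_ne_nil _ _, rfl, rfl⟩)⟩
  | nil =>
    have hv' : v = [] := by
      refine List.eq_nil_iff_forall_not_mem.2 fun d hd => hv ?_
      have h1 := h.head_min _ hc d (by simp [hd])
      have h2 := (h.bounds hc (a := d) (by simp [hd])).2
      simp only [List.nil_append, List.headI_cons] at h1
      rwa [le_antisymm h1 h2]
    have ht : t = [] := by
      refine List.eq_nil_iff_forall_not_mem.2 fun d hd => ?_
      have h1 := (List.pairwise_cons.1 (List.pairwise_append.1 h.heads_increasing).2.1).1 d hd
      have hd' : d ∈ s ++ ([] ++ (n + 1) :: (n + 1) :: v) :: t := by simp [hd]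
      obtain ⟨e, d, rfl⟩ := List.exists_cons_of_ne_nil (h.nonempty d hd')
      have h2 := (h.bounds hd' (a := e) (by simp)).2
      simp at h1
      omega
    subst hv' ht
    exact ⟨s, append_twin_iff.1 h, by simp [children]⟩

theorem of_mem_children {τ : List (List ℕ)} (h : IsTwinForm n σ) (hτ : τ ∈ children (n + 1) σ) :
    IsTwinForm (n + 1) τ := by
  rcases List.mem_cons.1 hτ with rfl | hτ
  · exact append_twin_iff.2 h
  · obtain ⟨s, u, v, t, hu, rfl, rfl⟩ := mem_insertTwinCycles.1 hτ
    have hN := h.notMem (c := u ++ v) (by simp)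
    rw [List.mem_append, not_or] at hN
    exact (insert_twin_iff hu hN.1 hN.2).2 h

theorem nodup (h : IsTwinForm n σ) : σ.Nodup :=
  h.heads_increasing.imp fun {c d} hcd e => by subst e; exact lt_irrefl _ hcd

-- Cycles are distinct, so the list sum is a sum over a set, matched with the fixed points by `k ↦
-- [k, k]`. This makes the number of fixed points additive over cycles.
open Classical in
theorem fixNum_eq (h : IsTwinForm n σ) : fixNum n σ = (σ.map fixCycle).sum := by
  have h1 : (σ.map fixCycle).sum = ∑ c ∈ σ.toFinset, fixCycle c :=
    (List.sum_toFinset _ h.nodup).symm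
  have h2 : ∀ c : List ℕ, fixCycle c = if ∃ k, c = [k, k] then 1 else 0 := by
    intro c
    match c with
    | [a, b] => simp [fixCycle, eq_comm]
    | [] => simp [fixCycle]
    | [_] => simp [fixCycle]
    | _ :: _ :: _ :: _ => simp [fixCycle]
  rw [h1, Finset.sum_congr rfl fun c _ => h2 c, ← Finset.card_filter, fixNum]
  refine Finset.card_bij (fun k _ => [k, k]) ?_ ?_ ?_
  · intro k hk
    simpa using (Finset.mem_filter.1 hk).2
  · intro k _ l _ hkl
    simpa using hkl
  · intro c hc
    obtain ⟨hc, k, rfl⟩ := Finset.mem_filter.1 hc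
    rw [List.mem_toFinset] at hc
    exact ⟨k, Finset.mem_filter.2 ⟨Finset.mem_Icc.2 (h.bounds hc (by simp)), hc⟩, rfl⟩

theorem weight_eq (h : IsTwinForm n σ) (v : PolyRing) :
    x ^ cap σ * v ^ fixNum n σ * q ^ cyc σ = weight v σ := by
  rw [h.fixNum_eq, cap, cyc, weight]
  clear h
  induction σ with
  | nil => simp
  | cons c σ ih =>
    rw [List.map_cons (f := weightCycle v), List.prod_cons, ← ih, weightCycle]
    simp only [List.map_cons, List.sum_cons, List.length_cons, pow_add]
    ring

end IsTwinForm

/-! ### The recurrences for `P` and `Q` and their consequences -/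

theorem stirlingPermsSecond_succ (n : ℕ) :
    stirlingPermsSecond (n + 1) =
      (stirlingPermsSecond n).biUnion fun σ => (children (n + 1) σ).toFinset := by
  ext τ
  simp only [Finset.mem_biUnion, mem_stirlingPermsSecond, List.mem_toFinset]
  exact ⟨fun h => h.exists_mem_children, fun ⟨σ, hσ, hτ⟩ => hσ.of_mem_children hτ⟩

theorem sum_weight_succ {v : PolyRing} (hv : insDer v = 2 * x * (1 - v)) (n : ℕ) :
    ∑ σ ∈ stirlingPermsSecond (n + 1), weight v σ =
      (2 * n * x + q * v) * ∑ σ ∈ stirlingPermsSecond n, weight v σ +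
        insDer (∑ σ ∈ stirlingPermsSecond n, weight v σ) := by
  rw [stirlingPermsSecond_succ, Finset.sum_biUnion, map_sum, Finset.mul_sum,
    ← Finset.sum_add_distrib]
  · refine Finset.sum_congr rfl fun σ hσ => ?_
    rw [mem_stirlingPermsSecond] at hσ
    rw [List.sum_toFinset _ (nodup_children fun c hc => hσ.notMem hc),
      sum_weight_children hv σ fun c hc b hb => Nat.lt_succ_of_le (hσ.bounds hc hb).2,
      hσ.length_flatten]
    push_cast
    ring
  · intro σ hσ ρ hρ hne
    rw [Finset.mem_coe, mem_stirlingPermsSecond] at hσ hρ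
    refine Finset.disjoint_left.2 fun τ h1 h2 => hne ?_
    rw [List.mem_toFinset] at h1 h2
    rw [← removeLetter_of_mem_children hσ.nonempty (fun c hc => hσ.notMem hc) h1,
      removeLetter_of_mem_children hρ.nonempty (fun c hc => hρ.notMem hc) h2]

theorem stirlingPermsSecond_zero : stirlingPermsSecond 0 = {[]} := by
  ext σ
  rw [mem_stirlingPermsSecond, Finset.mem_singleton]
  constructor
  · intro h
    refine List.eq_nil_iff_forall_not_mem.2 fun c hc => ?_
    obtain ⟨a, c, rfl⟩ := List.exists_cons_of_ne_nil (h.nonempty c hc)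
    have := h.bounds hc (a := a) (by simp)
    omega
  · rintro rfl
    refine ⟨by simp, fun i => ?_, by simp, by simp, by simp, by simp⟩
    rw [if_neg (by omega)]
    rfl

theorem P_eq_sum_weight (n : ℕ) : P n = ∑ σ ∈ stirlingPermsSecond n, weight y σ :=
  Finset.sum_congr rfl fun _ hσ => (mem_stirlingPermsSecond.1 hσ).weight_eq y

theorem Q_eq_sum_weight (n : ℕ) : Q n = ∑ σ ∈ stirlingPermsSecond n, weight 1 σ :=
  Finset.sum_congr rfl fun σ hσ => by
    rw [← (mem_stirlingPermsSecond.1 hσ).weight_eq 1, one_pow, mul_one]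

theorem P_zero : P 0 = 1 := by
  simp [P_eq_sum_weight, stirlingPermsSecond_zero, weight]

theorem Q_zero : Q 0 = 1 := by
  simp [Q_eq_sum_weight, stirlingPermsSecond_zero, weight]

theorem P_succ (n : ℕ) : P (n + 1) = (2 * n * x + q * y) * P n + insDer (P n) := by
  simpa only [P_eq_sum_weight] using sum_weight_succ insDer_y n

theorem Q_succ (n : ℕ) : Q (n + 1) = (2 * n * x + q) * Q n + insDer (Q n) := by
  have := sum_weight_succ (v := 1) (by simp) n
  rw [mul_one] at this
  simpa only [Q_eq_sum_weight] using this

/-- The index shift in `P (n + 1)` raises its parameter from `q * y` to `2 * x + q * y`. The factor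
`q` is harmless because `insDer q = 0`. -/
theorem P_succ_eq_binomConv (n : ℕ) : P (n + 1) = q * binomConv P cycleWeight n := by
  refine eq_of_recurrence (f := fun n => P (n + 1)) (g := fun n => q * binomConv P cycleWeight n)
    (a := 2 * x + q * y) ?_ (fun n => ?_) (fun n => ?_) n
  · simp [P_succ, P_zero, binomConv, cycleWeight]
  · rw [P_succ (n + 1)]; push_cast; ring
  · rw [binomConv_recurrence P_succ cycleWeight_succ, Derivation.leibniz, insDer_q]
    simp only [smul_eq_mul]
    ring

theorem binomConv_cycleWeight (n : ℕ) : binomConv P cycleWeight n = y * P n +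
    x * ∑ k ∈ Finset.range n,
      (n.choose k : PolyRing) * P k * 2 ^ (n - k) * eulerianA (n - k) := by
  rw [binomConv, Finset.Nat.sum_antidiagonal_eq_sum_range_succ_mk, Finset.sum_range_succ, add_comm,
    Finset.mul_sum]
  congr 1
  -- The top term `k = n` involves `cycleWeight 0 = y`.
  · simp [cycleWeight, mul_comm]
  · refine Finset.sum_congr rfl fun k hk => ?_
    have : n - k ≠ 0 := by have := Finset.mem_range.1 hk; omega
    rw [cycleWeight, if_neg this]
    ring

/-- With `a = q * (y - 1)` one has `insDer a = -2 * x * a`, so `insDer (a ^ k)` cancels `2 * k * x *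
a ^ k` and the powers of `a` satisfy the recurrence with parameter `a`. Finally `a + q = q * y`. -/
theorem P_eq_binomConv (n : ℕ) : P n = binomConv (fun k => (q * (y - 1)) ^ k) Q n := by
  refine eq_of_recurrence (a := q * y) ?_ P_succ (fun n => ?_) n
  · simp [P_zero, Q_zero, binomConv]
  · rw [binomConv_recurrence (a := q * (y - 1)) (fun n => ?_) Q_succ]
    · ring
    · rw [Derivation.leibniz_pow, Derivation.leibniz, map_sub, insDer_q, insDer_y]
      cases n with
      | zero => simp
      | succ n => simp; ring

end StirlingSecondKind

theorem mainTheorem3 :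
    -- initial conditions
    (P 0 = 1 ∧ P 1 = y * q) ∧
    -- the convolution recurrence
    (∀ n : ℕ, 1 ≤ n →
      P (n + 1) = q * y * P n +
        q * x * ∑ k ∈ Finset.range n,
          (n.choose k : PolyRing) * P k * 2 ^ (n - k) * eulerianA (n - k)) ∧
    -- the differential recurrence
    (∀ n : ℕ, 1 ≤ n →
      P (n + 1) = (2 * (n : PolyRing) * x + q * y) * P n
        + 2 * x * (1 - x) * MvPolynomial.pderiv 0 (P n)
        + 2 * x * (1 - y) * MvPolynomial.pderiv 1 (P n)) ∧
    -- `P(x,y,q;z) = exp(q z (y - 1)) Q(x,q;z)` as formal power series in `z`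
    egf P = PowerSeries.rescale (q * (y - 1)) (PowerSeries.exp PolyRing) * egf Q := by
  refine ⟨⟨P_zero, ?_⟩, fun n _ => ?_, fun n _ => ?_, egf_eq_rescale_exp_mul_egf P_eq_binomConv⟩
  · simp [P_succ, P_zero, mul_comm]
  · rw [P_succ_eq_binomConv, binomConv_cycleWeight]
    ring
  · rw [P_succ, insDer_apply]
    ring
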